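/- Let $\mathrm{ReLU}(z)=\max(0,\Re z)+i\max(0,\Im z)$ for $z\in\mathbb{C}$, applied coordinatewise to vectors, and let $\|\cdot\|$ be the Euclidean norm on $\mathbb{C}^n$. A deep ReLU network of width $n$ and depth $L$ is a function $\mathcal{N}=f_L\circ\cdots\circ f_1:\mathbb{C}^n\to\mathbb{C}^n$ given by matrices $W_1,\dots,W_L\in\mathbb{C}^{n\times n}$ and vectors $b_1,\dots,b_L\in\mathbb{C}^n$, where $f_i(x)=\mathrm{ReLU}(W_ix+b_i)$; its total rank is $k=\sum_{i=1}^{L}\mathrm{rank}(W_i)$. A diagonal-circulant neural network (DCNN) with ReLU activation, of width $n$ and depth $M\ge 1$, is a function $\mathcal{N}'=g_M\circ\cdots\circ g_1:\mathbb{C}^n\to\mathbb{C}^n$ with $g_j(x)=\mathrm{ReLU}(D_jC_jx+\beta_j)$, where $D_j\in\mathbb{C}^{n\times n}$ is diagonal, $C_j\in\mathbb{C}^{n\times n}$ is circulant and $\beta_j\in\mathbb{C}^n$. Let $n$ be a power of $2$, and let $\mathcal{N}$ be a deep ReLU network of width $n$, depth $L$ and total rank $k\ge 1$. Let $\mathcal{X}\subset\mathbb{C}^n$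 be a bounded set. Then for every $\epsilon>0$ there exists a DCNN $\mathcal{N}'$ with ReLU activation, of width $n$ and depth at most $9k$, such that $\|\mathcal{N}(x)-\mathcal{N}'(x)\|<\epsilon$ for all $x\in\mathcal{X}$. Moreover, if $\mathrm{rank}(W_i)$ divides $n$ for every $i=1,\dots,L$, then $\mathcal{N}'$ can moreover be chosen of depth at most $L+4k$. -/

import Mathlib

noncomputable section

/-- The ReLU on the complex plane: `max(0, Re z) + i max(0, Im z)`. -/
def complexReLU (z : ℂ) : ℂ := ⟨max 0 z.re, max 0 z.im⟩

/-- One layer of a deep ReLU network of width `n`: a weight matrix and a bias vector. -/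
structure DenseLayer (n : ℕ) where
  weight : Matrix (Fin n) (Fin n) ℂ
  bias : Fin n → ℂ

/-- The map `x ↦ ReLU (W x + b)` on `ℂⁿ`, with the ReLU applied coordinatewise. -/
def DenseLayer.eval {n : ℕ} (l : DenseLayer n) (x : EuclideanSpace ℂ (Fin n)) :
    EuclideanSpace ℂ (Fin n) :=
  WithLp.toLp 2 fun i => complexReLU (l.weight.mulVec x.ofLp i + l.bias i)

/-- A deep ReLU network of width `n`: its layers, listed from the input to the output. -/
structure DeepReLUNetwork (n : ℕ) where
  layers : List (DenseLayer n)

/-- The function `f_L ∘ ⋯ ∘ f_1` computed by a deep ReLU network with layers `[f_1, …, f_L]`. -/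
def DeepReLUNetwork.eval {n : ℕ} (N : DeepReLUNetwork n) (x : EuclideanSpace ℂ (Fin n)) :
    EuclideanSpace ℂ (Fin n) :=
  N.layers.foldl (fun y l => l.eval y) x

/-- The number of layers. -/
def DeepReLUNetwork.depth {n : ℕ} (N : DeepReLUNetwork n) : ℕ := N.layers.length

/-- The sum of the ranks of the weight matrices. -/
def DeepReLUNetwork.totalRank {n : ℕ} (N : DeepReLUNetwork n) : ℕ :=
  (N.layers.map fun l => l.weight.rank).sum

/-- The activations allowed in a diagonal-circulant network. -/
inductive DCActivation where
  | relu
  | identity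

/-- The function on `ℂ` denoted by an activation. -/
def DCActivation.eval : DCActivation → ℂ → ℂ
  | .relu => complexReLU
  | .identity => id

/-- One layer of a diagonal-circulant network of width `n`. The diagonal matrix is given by its
diagonal and the circulant matrix by its first column. -/
structure DCLayer (n : ℕ) where
  diag : Fin n → ℂ
  circ : Fin n → ℂ
  bias : Fin n → ℂ
  activation : DCActivation

/-- The map `x ↦ φ (D C x + b)` on `ℂⁿ`, with `D` diagonal, `C` circulant, and the activation `φ`
applied coordinatewise. -/
def DCLayer.eval {n : ℕ} (l : DCLayer n) (x : EuclideanSpace ℂ (Fin n)) :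
    EuclideanSpace ℂ (Fin n) :=
  WithLp.toLp 2 fun i => l.activation.eval
    ((Matrix.diagonal l.diag * Matrix.circulant l.circ).mulVec x.ofLp i + l.bias i)

/-- A diagonal-circulant neural network of width `n`: its layers, from the input to the output. -/
structure DCNN (n : ℕ) where
  layers : List (DCLayer n)

/-- The function `f_L ∘ ⋯ ∘ f_1` computed by a network with layers `[f_1, …, f_L]`. -/
def DCNN.eval {n : ℕ} (N : DCNN n) (x : EuclideanSpace ℂ (Fin n)) :
    EuclideanSpace ℂ (Fin n) :=
  N.layers.foldl (fun y l => l.eval y) x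

/-- The number of layers. -/
def DCNN.depth {n : ℕ} (N : DCNN n) : ℕ := N.layers.length

/-- The network has ReLU activation in every layer. -/
def DCNN.IsReLU {n : ℕ} (N : DCNN n) : Prop := ∀ l ∈ N.layers, l.activation = .relu

end

/-! A matrix `W` of rank `r` factors as `A P B`, with `P` a diagonal projection onto `r`
coordinates, so `A` and `B` may be taken equal to the identity outside `r` columns, respectively
rows. Each such factor is a limit of `r` products `D C D'`, one per altered row or column, hence of
`2r` products `D C`; with `P` this gives `4r + 1` (`mem_closure_diagCircMatrices_pow`). On a bounded
set, large biases make the intermediate ReLUs act as the identity (`exists_dcLayers_foldl_eq`), so a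
layer of rank `r` costs `4r + 1` layers and the network `L + 4k`. If no rank vanishes then `L ≤ k`
and this is at most `5k`; otherwise the network is constant and one layer suffices. -/

open Matrix Topology Filter
open scoped Pointwise

/-! ### Approximation of matrices by diagonal-circulant products. -/

section DiagonalCirculantMatrices

variable {n : ℕ}

/-- The products `D C` of a diagonal and a circulant matrix. -/
def diagCircMatrices (n : ℕ) : Set (Matrix (Fin n) (Fin n) ℂ) :=
  {M | ∃ d c : Fin n → ℂ, M = diagonal d * circulant c}

/-- The products `D C D'` with `C` circulant and `D`, `D'` diagonal. -/
def diagCircDiagMatrices (n : ℕ) : Set (Matrix (Fin n) (Fin n) ℂ) :=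
  {M | ∃ d c d' : Fin n → ℂ, M = diagonal d * circulant c * diagonal d'}

theorem diagonal_mem_diagCircMatrices (d : Fin n → ℂ) : diagonal d ∈ diagCircMatrices n := by
  rcases n with _ | n
  · exact ⟨d, d, Subsingleton.elim _ _⟩
  · exact ⟨d, Pi.single 0 1, by rw [circulant_single_one, mul_one]⟩

theorem diagCircDiagMatrices_subset_sq : diagCircDiagMatrices n ⊆ diagCircMatrices n ^ 2 := by
  rintro _ ⟨d, c, d', rfl⟩
  rw [pow_two]
  exact Set.mul_mem_mul ⟨d, c, rfl⟩ (diagonal_mem_diagCircMatrices d')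

/-- Having a diagonal factor on both sides is what makes the class stable under transposition, so
that results on rows pass to columns. -/
theorem transpose_mem_diagCircDiagMatrices {M : Matrix (Fin n) (Fin n) ℂ}
    (hM : M ∈ diagCircDiagMatrices n) : Mᵀ ∈ diagCircDiagMatrices n := by
  obtain ⟨d, c, d', rfl⟩ := hM
  exact ⟨d', fun i => c (-i), d, by
    simp [transpose_mul, Fin.transpose_circulant, Matrix.mul_assoc]⟩

theorem transpose_mem_diagCircDiagMatrices_pow (r : ℕ) {M : Matrix (Fin n) (Fin n) ℂ}
    (hM : M ∈ diagCircDiagMatrices n ^ r) : Mᵀ ∈ diagCircDiagMatrices n ^ r := by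
  induction r generalizing M with
  | zero =>
    rw [pow_zero, Set.mem_one] at hM ⊢
    rw [hM, transpose_one]
  | succ r ih =>
    rw [pow_succ] at hM
    obtain ⟨A, hA, B, hB, rfl⟩ := hM
    rw [pow_succ', transpose_mul]
    exact Set.mul_mem_mul (transpose_mem_diagCircDiagMatrices hB) (ih hA)

theorem closure_mul_mem {A B : Matrix (Fin n) (Fin n) ℂ} {s t : Set (Matrix (Fin n) (Fin n) ℂ)}
    (hA : A ∈ closure s) (hB : B ∈ closure t) : A * B ∈ closure (s * t) :=
  map_mem_closure₂ continuous_mul hA hB fun _ ha _ hb => Set.mul_mem_mul ha hb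

/-- The identity with one row replaced is a limit of products `D C D'`. -/
theorem updateRow_one_mem_closure (i : Fin n) (v : Fin n → ℂ) :
    (1 : Matrix (Fin n) (Fin n) ℂ).updateRow i v ∈ closure (diagCircDiagMatrices n) := by
  have : NeZero n := ⟨by rintro rfl; exact i.elim0⟩
  -- The circulant has diagonal `1` and off-diagonal entries of order `t`. Scaling row `i` by `t⁻¹`
  -- restores `v` there; scaling column `i` by `t * v i` corrects the entry `(i, i)`. The resulting
  -- entries are polynomial in `t`, so `t = 0` makes sense.
  let F : ℂ → Matrix (Fin n) (Fin n) ℂ := fun t => Matrix.of fun a b =>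
    if a = i then v b else if a = b then 1
    else if b = i then t * v (i - (a - b)) * (t * v i) else t * v (i - (a - b))
  have hF : Continuous F := by
    refine continuous_pi fun a => continuous_pi fun b => ?_
    simp only [F, Matrix.of_apply]
    split_ifs <;> fun_prop
  have h0 : F 0 = (1 : Matrix (Fin n) (Fin n) ℂ).updateRow i v := by
    ext a b
    simp only [F, Matrix.of_apply, updateRow_apply, one_apply]
    split_ifs <;> simp
  have hmem : ∀ t : ℂ, t ≠ 0 → F t ∈ diagCircDiagMatrices n := by
    intro t ht
    refine ⟨fun a => if a = i then t⁻¹ else 1, fun m => if m = 0 then 1 else t * v (i - m),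
      fun b => if b = i then t * v i else 1, ?_⟩
    ext a b
    simp only [F, Matrix.of_apply, mul_diagonal, diagonal_mul, circulant_apply, sub_eq_zero]
    by_cases ha : a = i
    · subst ha
      by_cases hb : b = a
      · subst hb
        simp [ht]
      · simp [ht, hb, Ne.symm hb]
    · by_cases hb : b = i
      · subst hb
        simp [ha]
      · simp [ha, hb]
  rw [← h0]
  refine mem_closure_of_tendsto (f := F) (b := 𝓝[≠] (0 : ℂ))
    (hF.continuousAt.tendsto.mono_left nhdsWithin_le_nhds) ?_
  filter_upwards [self_mem_nhdsWithin] with t ht using hmem t ht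

/-- Singularity means that `-t` is one of finitely many eigenvalues, and the nonzero ones stay away
from `0`. -/
theorem eventually_isUnit_add_smul_one (A : Matrix (Fin n) (Fin n) ℂ) :
    ∀ᶠ t in 𝓝[≠] (0 : ℂ), IsUnit (A + t • 1) := by
  have hfin : ((-spectrum ℂ A) \ {0} : Set ℂ).Finite := by
    refine Set.Finite.subset ?_ Set.sdiff_subset
    exact (Matrix.finite_spectrum A).neg
  have hnhds : ((-spectrum ℂ A) \ {0} : Set ℂ)ᶜ ∈ 𝓝 (0 : ℂ) :=
    hfin.isClosed.isOpen_compl.mem_nhds (by simp)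
  filter_upwards [nhdsWithin_le_nhds hnhds, self_mem_nhdsWithin] with t ht ht0
  have hsp : -t ∉ spectrum ℂ A := fun h => ht ⟨h, ht0⟩
  rw [spectrum.notMem_iff, Algebra.algebraMap_eq_smul_one] at hsp
  simpa [add_comm] using hsp.neg

/-- A matrix which agrees with the identity outside of `r` rows is a limit of products of `r`
matrices of the form `D C D'`. -/
theorem mem_closure_of_rows_eq_one (I : Finset (Fin n)) (W : Matrix (Fin n) (Fin n) ℂ)
    (hW : ∀ a, a ∉ I → W a = (1 : Matrix (Fin n) (Fin n) ℂ) a) :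
    W ∈ closure (diagCircDiagMatrices n ^ I.card) := by
  induction I using Finset.induction_on generalizing W with
  | empty =>
    have : W = 1 := by
      ext a b
      rw [hW a (Finset.notMem_empty a)]
    exact subset_closure (by simp [this])
  | insert i I hi ih =>
    set V := W.updateRow i ((1 : Matrix (Fin n) (Fin n) ℂ) i) with hV
    have hVrow : ∀ a, a ∉ I → V a = (1 : Matrix (Fin n) (Fin n) ℂ) a := by
      intro a ha
      by_cases hai : a = i
      · subst hai
        simp [hV]
      · simp only [hV]
        rw [updateRow_ne hai]
        exact hW a (by simp [hai, ha])
    -- `V` may be singular, so it is perturbed to `V + t`; the diagonal factor rescales the rows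
    -- outside `I` back to rows of the identity, as `ih` requires.
    let S : ℂ → Matrix (Fin n) (Fin n) ℂ := fun t =>
      diagonal (fun a => if a ∈ I then 1 else (1 + t)⁻¹) * (V + t • 1)
    have hS0 : S 0 = V := by
      have : (fun a : Fin n => if a ∈ I then (1 : ℂ) else (1 + 0)⁻¹) = fun _ => 1 := by
        ext; simp
      simp [S]
    have hS : Tendsto S (𝓝[≠] 0) (𝓝 V) := by
      have : ContinuousAt S 0 := by
        refine continuousAt_pi.2 fun a => continuousAt_pi.2 fun b => ?_
        simp only [S, diagonal_mul, Matrix.add_apply, Matrix.smul_apply]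
        split_ifs
        · fun_prop
        · refine ContinuousAt.mul (ContinuousAt.inv₀ (by fun_prop) (by simp)) (by fun_prop)
      simpa only [hS0] using this.tendsto.mono_left nhdsWithin_le_nhds
    have hne : ∀ᶠ t in 𝓝[≠] (0 : ℂ), 1 + t ≠ 0 := by
      refine nhdsWithin_le_nhds (ContinuousAt.eventually_ne (by fun_prop) (by simp))
    have hlim : Tendsto (fun t => (S t).updateRow i (W i)) (𝓝[≠] 0) (𝓝 W) := by
      have : W = V.updateRow i (W i) := by simp [hV]
      conv => rhs; rw [this]
      exact ((Continuous.matrix_updateRow i continuous_id continuous_const).tendsto V).comp hS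
    rw [← closure_closure]
    refine mem_closure_of_tendsto hlim ?_
    filter_upwards [hne, eventually_isUnit_add_smul_one V] with t ht hU
    have hSmem : S t ∈ closure (diagCircDiagMatrices n ^ I.card) := by
      refine ih (S t) fun a ha => ?_
      ext b
      simp only [S, diagonal_mul, Matrix.add_apply, Matrix.smul_apply, hVrow a ha, if_neg ha,
        smul_eq_mul]
      field_simp
    have hSunit : IsUnit (S t).det := by
      rw [← isUnit_iff_isUnit_det]
      refine IsUnit.mul ?_ hU
      rw [isUnit_iff_isUnit_det, det_diagonal, isUnit_iff_ne_zero]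
      refine Finset.prod_ne_zero_iff.2 fun a _ => ?_
      split_ifs
      · exact one_ne_zero
      · exact inv_ne_zero ht
    -- Invertibility of `S t` lets the new row be written as a combination of its rows.
    have heq : (S t).updateRow i (W i) =
        (1 : Matrix (Fin n) (Fin n) ℂ).updateRow i (W i ᵥ* (S t)⁻¹) * S t := by
      rw [updateRow_mul, vecMul_vecMul, nonsing_inv_mul _ hSunit, vecMul_one, one_mul]
    rw [Finset.card_insert_of_notMem hi, pow_succ', heq]
    exact closure_mul_mem (updateRow_one_mem_closure i _) hSmem

theorem mem_closure_of_cols_eq_one (I : Finset (Fin n)) (W : Matrix (Fin n) (Fin n) ℂ)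
    (hW : ∀ b, b ∉ I → ∀ a, W a b = (1 : Matrix (Fin n) (Fin n) ℂ) a b) :
    W ∈ closure (diagCircDiagMatrices n ^ I.card) := by
  have hT : Wᵀ ∈ closure (diagCircDiagMatrices n ^ I.card) := by
    refine mem_closure_of_rows_eq_one I _ fun a ha => ?_
    ext b
    rw [transpose_apply, hW a ha, one_apply, one_apply]
    simp only [eq_comm]
  have := map_mem_closure (f := fun M : Matrix (Fin n) (Fin n) ℂ => Mᵀ)
    (Continuous.matrix_transpose continuous_id) hT
    (fun M hM => transpose_mem_diagCircDiagMatrices_pow _ hM)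
  simpa using this

theorem exists_eq_mul_diagonal_indicator_mul (W : Matrix (Fin n) (Fin n) ℂ) :
    ∃ (I : Finset (Fin n)) (A B : Matrix (Fin n) (Fin n) ℂ), I.card = W.rank ∧
      W = A * diagonal (fun a => if a ∈ I then 1 else 0) * B := by
  obtain ⟨V, U, e, hV, hU, h⟩ := Matrix.exists_rank_normal_form W
  refine ⟨Finset.univ.filter fun a => (e a).isLeft, V⁻¹, U⁻¹, ?_, ?_⟩
  · have h1 : (Finset.univ.filter fun a => (e a).isLeft) =
        (Finset.univ.map (Function.Embedding.inl)).map e.symm.toEmbedding := by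
      ext a
      rw [Finset.mem_map_equiv]
      rcases h : e a with x | x <;> simp [h]
    rw [h1]
    simp
  · have hP : (fromBlocks 1 0 0 0 : Matrix _ _ ℂ).submatrix e e =
        diagonal (fun a => if a ∈ Finset.univ.filter (fun a => (e a).isLeft) then 1 else 0) := by
      rw [← diagonal_one, ← diagonal_zero, fromBlocks_diagonal]
      rw [submatrix_diagonal_equiv]
      congr 1
      ext a
      rcases h : e a with x | x <;> simp [h]
    rw [← hP, ← h]
    rw [isUnit_iff_isUnit_det] at hV hU
    rw [Matrix.mul_assoc, mul_nonsing_inv_cancel_right _ _ hU, nonsing_inv_mul_cancel_left _ _ hV]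

/-- A matrix of rank `r` is a limit of products of `4 r + 1` matrices of the form `D C`. -/
theorem mem_closure_diagCircMatrices_pow (W : Matrix (Fin n) (Fin n) ℂ) :
    W ∈ closure (diagCircMatrices n ^ (4 * W.rank + 1)) := by
  obtain ⟨I, A, B, hI, hW⟩ := exists_eq_mul_diagonal_indicator_mul W
  set P : Matrix (Fin n) (Fin n) ℂ := diagonal fun a => if a ∈ I then 1 else 0 with hP
  -- `P` kills the columns of `A` and the rows of `B` outside `I`, so these can be reset to the
  -- identity.
  let A' : Matrix (Fin n) (Fin n) ℂ := Matrix.of fun a b =>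
    if b ∈ I then A a b else (1 : Matrix (Fin n) (Fin n) ℂ) a b
  let B' : Matrix (Fin n) (Fin n) ℂ := Matrix.of fun a b =>
    if a ∈ I then B a b else (1 : Matrix (Fin n) (Fin n) ℂ) a b
  have hA : A * P = A' * P := by
    ext a b
    simp only [hP, mul_diagonal, A', Matrix.of_apply]
    split_ifs <;> simp
  have hB : P * B = P * B' := by
    ext a b
    simp only [hP, diagonal_mul, B', Matrix.of_apply]
    split_ifs <;> simp
  have hsub : diagCircDiagMatrices n ^ I.card ⊆ diagCircMatrices n ^ (2 * I.card) := by
    rw [pow_mul]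
    exact Set.pow_subset_pow_left diagCircDiagMatrices_subset_sq
  have hA' : A' ∈ closure (diagCircMatrices n ^ (2 * I.card)) :=
    closure_mono hsub (mem_closure_of_cols_eq_one I A' fun b hb a => by simp [A', hb])
  have hB' : B' ∈ closure (diagCircMatrices n ^ (2 * I.card)) :=
    closure_mono hsub (mem_closure_of_rows_eq_one I B' fun a ha => by ext b; simp [B', ha])
  have hPm : P ∈ closure (diagCircMatrices n) := subset_closure (diagonal_mem_diagCircMatrices _)
  have hfac : W = A' * P * B' := by
    rw [hW, hA, Matrix.mul_assoc, hB, ← Matrix.mul_assoc]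
  have hexp : diagCircMatrices n ^ (4 * W.rank + 1) =
      diagCircMatrices n ^ (2 * I.card) * diagCircMatrices n * diagCircMatrices n ^ (2 * I.card) := by
    rw [← pow_succ, ← pow_add, hI]
    congr 1
    ring
  rw [hexp, hfac]
  exact closure_mul_mem (closure_mul_mem hA' hPm) hB'

end DiagonalCirculantMatrices

/-! ### From matrix products to ReLU networks. -/

section Networks

variable {n : ℕ}

theorem uniformContinuous_complexReLU : UniformContinuous complexReLU := by
  have h1 : UniformContinuous fun z : ℂ => max 0 z.re :=
    (LipschitzWith.id.const_max 0).uniformContinuous.comp Complex.uniformContinuous_re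
  have h2 : UniformContinuous fun z : ℂ => max 0 z.im :=
    (LipschitzWith.id.const_max 0).uniformContinuous.comp Complex.uniformContinuous_im
  exact Complex.equivRealProdCLM.symm.toContinuousLinearMap.uniformContinuous.comp (h1.prodMk h2)

theorem complexReLU_eq_self {z : ℂ} (hre : 0 ≤ z.re) (him : 0 ≤ z.im) : complexReLU z = z := by
  simp [complexReLU, hre, him]

theorem complexReLU_complexReLU (z : ℂ) : complexReLU (complexReLU z) = complexReLU z :=
  complexReLU_eq_self (le_max_left _ _) (le_max_left _ _)

theorem DenseLayer.uniformContinuous_eval (l : DenseLayer n) : UniformContinuous l.eval := by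
  refine (PiLp.uniformContinuous_toLp 2 _).comp (uniformContinuous_pi.2 fun i => ?_)
  refine uniformContinuous_complexReLU.comp (UniformContinuous.add ?_ uniformContinuous_const)
  have h : UniformContinuous (Matrix.mulVecLin l.weight).toContinuousLinearMap :=
    ContinuousLinearMap.uniformContinuous _
  exact (Pi.uniformContinuous_proj _ i).comp (h.comp (PiLp.uniformContinuous_ofLp 2 _))

theorem uniformContinuous_foldl_denseLayer_eval (ls : List (DenseLayer n)) :
    UniformContinuous fun x => ls.foldl (fun y l => l.eval y) x := by
  induction ls with
  | nil => exact uniformContinuous_id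
  | cons l ls ih => exact ih.comp l.uniformContinuous_eval

/-- On a bounded set, the composition of an affine map given by a product of diagonal-circulant
matrices with the ReLU is computed by a ReLU network with one layer for each factor. -/
theorem exists_dcLayers_foldl_eq (r : ℕ) (A : Matrix (Fin n) (Fin n) ℂ)
    (hA : A ∈ diagCircMatrices n ^ (r + 1)) (X : Set (EuclideanSpace ℂ (Fin n)))
    (hX : Bornology.IsBounded X) (b : Fin n → ℂ) :
    ∃ gs : List (DCLayer n), gs.length = r + 1 ∧ (∀ g ∈ gs, g.activation = .relu) ∧
      ∀ x ∈ X, gs.foldl (fun y g => g.eval y) x = (DenseLayer.mk A b).eval x := by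
  induction r generalizing A X b with
  | zero =>
    obtain ⟨d, c, rfl⟩ := by simpa using hA
    exact ⟨[⟨d, c, b, .relu⟩], rfl, by simp, fun x _ => rfl⟩
  | succ r ih =>
    rw [pow_succ] at hA
    obtain ⟨A₂, hA₂, _, ⟨d, c, rfl⟩, rfl⟩ := hA
    set A₁ := diagonal d * circulant c with hA₁
    let f : EuclideanSpace ℂ (Fin n) → Fin n → ℂ := fun x => A₁ *ᵥ x.ofLp
    have hf : Continuous f := by fun_prop
    have hbdd : Bornology.IsBounded (f '' X) :=
      (hX.isCompact_closure.image hf).isBounded.subset (Set.image_mono subset_closure)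
    obtain ⟨R, hR⟩ := hbdd.exists_norm_le
    have hcoord : ∀ x ∈ X, ∀ i, ‖f x i‖ ≤ R := fun x hx i =>
      (norm_le_pi_norm (f x) i).trans (hR _ ⟨x, hx, rfl⟩)
    -- This shift moves all preactivations into the closed first quadrant, where the ReLU is the
    -- identity; the final bias `b - A₂ *ᵥ β` undoes it.
    let β : Fin n → ℂ := fun _ => ⟨R, R⟩
    let g : DCLayer n := ⟨d, c, β, .relu⟩
    have hg : ∀ x ∈ X, g.eval x = WithLp.toLp 2 (f x + β) := by
      intro x hx
      refine congrArg (WithLp.toLp 2) (funext fun i => ?_)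
      refine complexReLU_eq_self ?_ ?_
      · have := (abs_le.1 ((Complex.abs_re_le_norm _).trans (hcoord x hx i))).1
        change 0 ≤ (f x i).re + R
        linarith
      · have := (abs_le.1 ((Complex.abs_im_le_norm _).trans (hcoord x hx i))).1
        change 0 ≤ (f x i).im + R
        linarith
    have hbdd' : Bornology.IsBounded ((fun x => WithLp.toLp 2 (f x + β)) '' X) :=
      (hX.isCompact_closure.image (by fun_prop)).isBounded.subset (Set.image_mono subset_closure)
    obtain ⟨gs, hlen, hrelu, hgs⟩ := ih A₂ hA₂ _ hbdd' (b - A₂ *ᵥ β)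
    refine ⟨g :: gs, by simp [hlen], ?_, fun x hx => ?_⟩
    · intro g' hg'
      rcases List.mem_cons.1 hg' with rfl | h
      · rfl
      · exact hrelu _ h
    · rw [List.foldl_cons, hg x hx, hgs _ ⟨x, hx, rfl⟩]
      refine congrArg (WithLp.toLp 2) (funext fun i => congrArg complexReLU ?_)
      simp [f, mulVec_add, mulVec_mulVec]

/-- A dense ReLU layer of rank `r` is approximated on bounded sets by `4 r + 1` diagonal-circulant
ReLU layers. -/
theorem DenseLayer.exists_dcLayers_approx (l : DenseLayer n) (X : Set (EuclideanSpace ℂ (Fin n)))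
    (hX : Bornology.IsBounded X) (ε : ℝ) (hε : 0 < ε) :
    ∃ gs : List (DCLayer n), gs.length = 4 * l.weight.rank + 1 ∧
      (∀ g ∈ gs, g.activation = .relu) ∧
      ∀ x ∈ X, ‖l.eval x - gs.foldl (fun y g => g.eval y) x‖ < ε := by
  let F : Matrix (Fin n) (Fin n) ℂ × EuclideanSpace ℂ (Fin n) → EuclideanSpace ℂ (Fin n) :=
    fun p => (DenseLayer.mk p.1 l.bias).eval p.2
  have hF : Continuous F := by
    refine (PiLp.continuous_toLp 2 _).comp (continuous_pi fun i => ?_)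
    refine uniformContinuous_complexReLU.continuous.comp (Continuous.add ?_ continuous_const)
    exact (continuous_apply i).comp
      (Continuous.matrix_mulVec continuous_fst ((PiLp.continuous_ofLp 2 _).comp continuous_snd))
  -- Compactness of `closure X` makes the choice of `A` uniform in `x`.
  have hev : ∀ᶠ A in 𝓝 l.weight, ∀ x ∈ closure X, ‖F (l.weight, x) - F (A, x)‖ < ε := by
    refine hX.isCompact_closure.eventually_forall_of_forall_eventually
      (P := fun A x => ‖F (l.weight, x) - F (A, x)‖ < ε) fun y _ => ?_
    have hc : Continuous fun z : Matrix (Fin n) (Fin n) ℂ × EuclideanSpace ℂ (Fin n) =>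
        ‖F (l.weight, z.2) - F (z.1, z.2)‖ := by fun_prop
    exact hc.continuousAt.eventually_lt continuousAt_const (by simpa using hε)
  obtain ⟨A, hA, hAmem⟩ := mem_closure_iff_nhds.1 (mem_closure_diagCircMatrices_pow l.weight) _ hev
  obtain ⟨gs, hlen, hrelu, hgs⟩ := exists_dcLayers_foldl_eq _ A hAmem X hX l.bias
  refine ⟨gs, hlen, hrelu, fun x hx => ?_⟩
  rw [hgs x hx]
  exact hA x (subset_closure hx)

theorem exists_dcLayers_foldl_approx (ls : List (DenseLayer n))
    (X : Set (EuclideanSpace ℂ (Fin n))) (hX : Bornology.IsBounded X) (ε : ℝ) (hε : 0 < ε) :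
    ∃ gs : List (DCLayer n),
      gs.length = ls.length + 4 * (ls.map fun l => l.weight.rank).sum ∧
      (∀ g ∈ gs, g.activation = .relu) ∧
      ∀ x ∈ X, ‖ls.foldl (fun y l => l.eval y) x - gs.foldl (fun y g => g.eval y) x‖ < ε := by
  induction ls generalizing X ε with
  | nil => exact ⟨[], rfl, by simp, by simpa using fun _ _ => hε⟩
  | cons l ls ih =>
    obtain ⟨δ, hδ, hδF⟩ := Metric.uniformContinuous_iff.1
      (uniformContinuous_foldl_denseLayer_eval ls) (ε / 2) (half_pos hε)
    obtain ⟨gs, hlen, hrelu, hgs⟩ := l.exists_dcLayers_approx X hX δ hδ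
    have hbl : Bornology.IsBounded (l.eval '' X) :=
      (hX.isCompact_closure.image l.uniformContinuous_eval.continuous).isBounded.subset
        (Set.image_mono subset_closure)
    -- The tail is fed the outputs of `gs`, not of `l`, so it has to be approximated on this set.
    have hbg : Bornology.IsBounded ((fun x => gs.foldl (fun y g => g.eval y) x) '' X) := by
      refine (hbl.thickening (δ := δ)).subset ?_
      rintro _ ⟨x, hx, rfl⟩
      refine Metric.mem_thickening_iff.2 ⟨l.eval x, ⟨x, hx, rfl⟩, ?_⟩
      rw [dist_comm, dist_eq_norm]
      exact hgs x hx
    obtain ⟨hs, hlen', hrelu', hhs⟩ := ih _ hbg (ε / 2) (half_pos hε)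
    refine ⟨gs ++ hs, ?_, ?_, fun x hx => ?_⟩
    · simp only [List.length_append, hlen, hlen', List.length_cons, List.map_cons, List.sum_cons]
      ring
    · intro g hg
      rcases List.mem_append.1 hg with h | h
      · exact hrelu g h
      · exact hrelu' g h
    · rw [List.foldl_append, List.foldl_cons, ← dist_eq_norm]
      have h1 := hδF (a := l.eval x) (b := gs.foldl (fun y g => g.eval y) x)
        (by rw [dist_eq_norm]; exact hgs x hx)
      have h2 := hhs _ ⟨x, hx, rfl⟩
      rw [← dist_eq_norm] at h2
      exact (dist_triangle _ _ _).trans_lt (by linarith)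

theorem foldl_denseLayer_eval_eq_of_weight_eq_zero {ls : List (DenseLayer n)} {l : DenseLayer n}
    (hl : l ∈ ls) (hw : l.weight = 0) (x y : EuclideanSpace ℂ (Fin n)) :
    ls.foldl (fun y l => l.eval y) x = ls.foldl (fun y l => l.eval y) y := by
  obtain ⟨s, t, rfl⟩ := List.append_of_mem hl
  simp [List.foldl_append, DenseLayer.eval, hw]

/-- Thanks to this, a constant network is a single ReLU layer with zero weight and its value as
bias. -/
theorem complexReLU_foldl_denseLayer_eval {ls : List (DenseLayer n)} (hls : ls ≠ [])
    (x : EuclideanSpace ℂ (Fin n)) (i : Fin n) :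
    complexReLU ((ls.foldl (fun y l => l.eval y) x).ofLp i) =
      (ls.foldl (fun y l => l.eval y) x).ofLp i := by
  rw [← List.dropLast_append_getLast hls, List.foldl_append]
  exact complexReLU_complexReLU _

theorem DeepReLUNetwork.depth_le_totalRank (N : DeepReLUNetwork n)
    (h : ∀ l ∈ N.layers, l.weight.rank ≠ 0) : N.depth ≤ N.totalRank := by
  have := List.card_nsmul_le_sum (N.layers.map fun l => l.weight.rank) 1 fun r hr => by
    obtain ⟨l, hl, rfl⟩ := List.mem_map.1 hr
    exact Nat.one_le_iff_ne_zero.2 (h l hl)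
  simpa [DeepReLUNetwork.depth, DeepReLUNetwork.totalRank] using this

end Networks

theorem theorem3 (n : ℕ) (hn : ∃ m : ℕ, n = 2 ^ m)
    (N : DeepReLUNetwork n) (hk : 1 ≤ N.totalRank)
    (X : Set (EuclideanSpace ℂ (Fin n))) (hX : Bornology.IsBounded X)
    (ε : ℝ) (hε : 0 < ε) :
    ∃ N' : DCNN n, N'.IsReLU ∧
      (∀ x ∈ X, ‖N.eval x - N'.eval x‖ < ε) ∧
      1 ≤ N'.depth ∧
      N'.depth ≤ 9 * N.totalRank ∧
      ((∀ l ∈ N.layers, l.weight.rank ∣ n) → N'.depth ≤ N.depth + 4 * N.totalRank) := by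

  -- Layers of rank zero add to `L` but not to `k`, so with them `L + 4k` need not be at most `9k`.
  by_cases h0 : ∃ l ∈ N.layers, l.weight.rank = 0
  · obtain ⟨l, hl, hr⟩ := h0
    have hw : l.weight = 0 := by
      have h := hr
      rwa [Matrix.rank, Module.finrank_zero_iff, Submodule.subsingleton_iff_eq_bot,
        LinearMap.range_eq_bot, ← Matrix.toLin'_apply', LinearEquiv.map_eq_zero_iff] at h
    refine ⟨⟨[⟨0, 0, (N.eval 0).ofLp, .relu⟩]⟩, by simp [DCNN.IsReLU], fun x _ => ?_, le_rfl, ?_,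
      fun _ => ?_⟩
    · have hN : N.eval x = N.eval 0 := foldl_denseLayer_eval_eq_of_weight_eq_zero hl hw x 0
      have hc : (DCNN.mk [⟨0, 0, (N.eval 0).ofLp, .relu⟩]).eval x = N.eval 0 := by
        ext i
        have := complexReLU_foldl_denseLayer_eval (List.ne_nil_of_mem hl) 0 i
        simpa [DCNN.eval, DeepReLUNetwork.eval, DCLayer.eval, DCActivation.eval] using this
      rw [hN, hc, sub_self, norm_zero]
      exact hε
    · change 1 ≤ _
      omega
    · change 1 ≤ _
      omega
  · push Not at h0
    obtain ⟨gs, hlen, hrelu, hgs⟩ := exists_dcLayers_foldl_approx N.layers X hX ε hε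
    have hd : N.depth ≤ N.totalRank := N.depth_le_totalRank h0
    have hlen' : (DCNN.mk gs).depth = N.depth + 4 * N.totalRank := hlen
    exact ⟨⟨gs⟩, hrelu, hgs, by omega, by omega, fun _ => hlen'.le⟩
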